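/- Let $\mathbb{D}$ be the open unit disc in $\mathbb{C}$, let $\alpha>-1$, and let $H\neq\{0\}$ be a complex Hilbert space (for instance a separable infinite-dimensional one). Let $dA$ be area measure on $\mathbb{D}$ divided by $\pi$ and $dA_\alpha(z)=(\alpha+1)(1-|z|^2)^\alpha\,dA(z)$. The $H$-valued weighted Bergman space $\mathcal{A}^2_\alpha(H)$ is the Hilbert space of all analytic functions $f:\mathbb{D}\to H$ with $\int_{\mathbb{D}}\|f(z)\|^2\,dA_\alpha(z)<\infty$, with the inner product $\langle f,g\rangle=\int_{\mathbb{D}}\langle f(z),g(z)\rangle\,dA_\alpha(z)$. For an analytic self-map $\Phi$ of $\mathbb{D}$ (an analytic function $\Phi:\mathbb{D}\to\mathbb{D}$) let $C_\Phi f=f\circ\Phi$ be the composition operator, a bounded operator on $\mathcal{A}^2_\alpha(H)$. Let $\Phi$ be an analytic self-map of $\mathbb{D}$. Then the adjoint $C_\Phi^*$ on $\mathcal{A}^2_\alpha(H)$ is a composition operator, that is, $C_\Phi^*=C_\Psi$ for some analytic self-map $\Psi$ of $\mathbb{D}$, if and only if there is $\lambda\in\mathbb{C}$ with $|\lambda|\le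 1$ such that $\Phi(z)=\lambda z$ for all $z\in\mathbb{D}$. In that case, for an analytic self-map $\Psi$ of $\mathbb{D}$, $C_\Phi^*=C_\Psi$ holds if and only if $\Psi(z)=\overline{\lambda}z$ for all $z\in\mathbb{D}$. -/

import Mathlib

set_option linter.unusedSectionVars false

section
open Metric MeasureTheory Set Filter Topology

/-- `Φ` restricts to an analytic self-map of the open unit disc `ball 0 1`. Values of `Φ` outside
the disc are irrelevant. -/
def IsAnalyticSelfMap (Φ : ℂ → ℂ) : Prop :=
  DifferentiableOn ℂ Φ (ball 0 1) ∧ MapsTo Φ (ball 0 1) (ball 0 1)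

namespace BergmanSpace

/-! ### Subharmonicity estimates on circles -/

section
variable {H : Type*} [NormedAddCommGroup H] [InnerProductSpace ℂ H]

/-- `‖f‖ ^ 2` is dominated by its Poisson integral. -/
theorem norm_sq_le_poisson {f : ℂ → H} {R : ℝ} {w : ℂ} (hf : DiffContOnCl ℂ f (ball 0 R))
    (hw : w ∈ ball (0 : ℂ) R) :
    ‖f w‖ ^ 2 ≤ Real.circleAverage
      ((Complex.re ∘ herglotzRieszKernel 0 w) • (fun ζ => ‖f ζ‖ ^ 2)) 0 R := by
  have hR : 0 < R := pos_of_mem_ball hw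
  set h : ℂ → ℂ := fun ζ => 2 * inner ℂ (f w) (f ζ) - (‖f w‖ ^ 2 : ℝ) with hh
  have h1 : DiffContOnCl ℂ h (ball 0 R) := by
    have := ((innerSL ℂ (f w)).differentiable.comp_diffContOnCl hf)
    exact ((this.const_smul (2:ℂ)).sub_const _)
  have h2 := h1.circleAverage_re_herglotzRieszKernel_smul hw
  have hc : ContinuousOn f (sphere 0 |R|) := by
    rw [abs_of_pos hR]
    exact hf.2.mono (sphere_subset_closedBall.trans_eq (closure_ball 0 hR.ne').symm)
  have hk := continuousOn_herglotzRieszKernel_sphere hw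
  have hk' : ContinuousOn (Complex.re ∘ herglotzRieszKernel 0 w) (sphere 0 |R|) :=
    Complex.continuous_re.comp_continuousOn hk
  have hhc : ContinuousOn h (sphere 0 |R|) := by
    rw [abs_of_pos hR]
    exact h1.2.mono (sphere_subset_closedBall.trans_eq (closure_ball 0 hR.ne').symm)
  have h3 := Complex.reCLM.circleAverage_comp_comm
    (f := (Complex.re ∘ herglotzRieszKernel 0 w) • h) (c := 0) (R := R)
    ((hk'.smul hhc).circleIntegrable')
  rw [h2] at h3
  have h4 : Complex.reCLM (h w) = ‖f w‖ ^ 2 := by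
    simp only [hh, Complex.reCLM_apply, Complex.sub_re, Complex.ofReal_re]
    have := inner_self_eq_norm_sq (𝕜 := ℂ) (f w)
    rw [RCLike.re_to_complex] at this
    simp only [Complex.mul_re, Complex.re_ofNat, Complex.im_ofNat, zero_mul, sub_zero]
    linarith
  rw [← h4, ← h3]
  apply Real.circleAverage_mono
  · exact ((Complex.reCLM.continuous.comp_continuousOn (hk'.smul hhc)).circleIntegrable')
  · exact ((hk'.smul (hc.norm.pow 2)).circleIntegrable')
  · intro ζ hζ
    rw [abs_of_pos hR] at hζ
    have hP : 0 ≤ (Complex.re ∘ herglotzRieszKernel 0 w) ζ := by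
      have := le_re_herglotzRieszKernel hζ hw
      refine le_trans ?_ this
      have : ‖w - 0‖ < R := by simpa using hw
      apply div_nonneg <;> nlinarith [norm_nonneg (w - 0)]
    have : (h ζ).re ≤ ‖f ζ‖ ^ 2 := by
      simp only [hh, Complex.sub_re, Complex.ofReal_re, Complex.mul_re, Complex.re_ofNat,
        Complex.im_ofNat, zero_mul, sub_zero]
      have h5 := norm_sub_sq (𝕜 := ℂ) (f w) (f ζ)
      simp only [RCLike.re_to_complex] at h5
      nlinarith [sq_nonneg ‖f w - f ζ‖]
    simp only [Function.comp_apply, Pi.smul_apply', Complex.reCLM_apply, Complex.smul_re,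
      smul_eq_mul] at *
    exact mul_le_mul_of_nonneg_left this hP

/-- A subordination inequality for the circle means of `‖f ∘ Φ‖ ^ 2`. -/
theorem circleAverage_comp_le {f : ℂ → H} {Φ : ℂ → ℂ} {r R : ℝ}
    (hf : DifferentiableOn ℂ f (ball 0 1)) (hΦ : IsAnalyticSelfMap Φ) (hr : 0 < r) (hr1 : r < 1)
    (hR1 : R < 1) (hrR : ∀ z ∈ closedBall (0 : ℂ) r, Φ z ∈ ball (0 : ℂ) R) :
    Real.circleAverage (fun ζ => ‖f (Φ ζ)‖ ^ 2) 0 r ≤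
      (R + ‖Φ 0‖) / (R - ‖Φ 0‖) * Real.circleAverage (fun ζ => ‖f ζ‖ ^ 2) 0 R := by
  have h0 := hrR 0 (by simp [hr.le])
  have hR : 0 < R := pos_of_mem_ball h0
  have hsub : closedBall (0 : ℂ) R ⊆ ball 0 1 := closedBall_subset_ball hR1
  have hrsub : closedBall (0 : ℂ) r ⊆ ball 0 1 := closedBall_subset_ball hr1
  have hfD : DiffContOnCl ℂ f (ball 0 R) := (hf.mono hsub).diffContOnCl_ball subset_rfl
  have hfc : ContinuousOn (fun ζ => ‖f ζ‖ ^ 2) (sphere 0 |R|) := by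
    rw [abs_of_pos hR]
    exact ((hf.continuousOn.mono (sphere_subset_closedBall.trans hsub)).norm.pow 2)
  have hg : CircleIntegrable (fun ζ => ‖f ζ‖ ^ 2) 0 R := hfc.circleIntegrable'
  have hgC : CircleIntegrable (fun ζ => ((‖f ζ‖ ^ 2 : ℝ) : ℂ)) 0 R :=
    (Complex.continuous_ofReal.comp_continuousOn hfc).circleIntegrable'
  set G : ℂ → ℂ := fun w => Real.circleAverage
    (fun ζ ↦ herglotzRieszKernel 0 w ζ • ((‖f ζ‖ ^ 2 : ℝ) : ℂ)) 0 R with hG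
  have hGd : DifferentiableOn ℂ G (ball 0 R) :=
    differentiableOn_circleAverage_herglotzRieszKernel_smul hgC
  have hGre : ∀ w ∈ ball (0 : ℂ) R, (G w).re = Real.circleAverage
      ((Complex.re ∘ herglotzRieszKernel 0 w) • (fun ζ => ‖f ζ‖ ^ 2)) 0 R := fun w hw =>
    re_circleAverage_herglotzRieszKernel_smul hg hw
  have hGΦ : DifferentiableOn ℂ (G ∘ Φ) (closedBall 0 r) :=
    hGd.comp (hΦ.1.mono hrsub) hrR
  have hGΦ' : DiffContOnCl ℂ (G ∘ Φ) (ball 0 |r|) := by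
    rw [abs_of_pos hr]; exact hGΦ.diffContOnCl_ball subset_rfl
  have hmean := hGΦ'.circleAverage
  have hint : ContinuousOn (G ∘ Φ) (sphere 0 |r|) := by
    rw [abs_of_pos hr]; exact hGΦ.continuousOn.mono sphere_subset_closedBall
  have hre := Complex.reCLM.circleAverage_comp_comm hint.circleIntegrable'
  rw [hmean] at hre
  calc Real.circleAverage (fun ζ => ‖f (Φ ζ)‖ ^ 2) 0 r
      ≤ Real.circleAverage (Complex.reCLM ∘ G ∘ Φ) 0 r := by
        apply Real.circleAverage_mono
        · apply ContinuousOn.circleIntegrable'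
          rw [abs_of_pos hr]
          have := (hf.continuousOn.comp (hΦ.1.continuousOn) hΦ.2).mono
            (sphere_subset_closedBall.trans hrsub)
          exact this.norm.pow 2
        · exact (Complex.reCLM.continuous.comp_continuousOn hint).circleIntegrable'
        · intro z hz
          rw [abs_of_pos hr] at hz
          have hz' := hrR z (sphere_subset_closedBall hz)
          refine (norm_sq_le_poisson hfD hz').trans_eq ?_
          rw [← hGre _ hz']; rfl
    _ = (G (Φ 0)).re := hre
    _ = Real.circleAverage
      ((Complex.re ∘ herglotzRieszKernel 0 (Φ 0)) • (fun ζ => ‖f ζ‖ ^ 2)) 0 R := hGre _ h0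
    _ ≤ Real.circleAverage (((R + ‖Φ 0‖) / (R - ‖Φ 0‖)) • fun ζ => ‖f ζ‖ ^ 2) 0 R := by
        apply Real.circleAverage_mono
        · exact (((Complex.continuous_re.comp_continuousOn
            (continuousOn_herglotzRieszKernel_sphere h0))).smul hfc).circleIntegrable'
        · exact (hfc.const_smul _).circleIntegrable'
        · intro ζ hζ
          rw [abs_of_pos hR] at hζ
          have := re_herglotzRieszKernel_le hζ h0
          simp only [sub_zero] at this
          simp only [Pi.smul_apply', Pi.smul_apply, Function.comp_apply, smul_eq_mul,
            herglotzRieszKernel_def, sub_zero]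
          exact mul_le_mul_of_nonneg_right this (by positivity)
    _ = _ := by rw [Real.circleAverage_smul, smul_eq_mul]

/-- A quantitative form of `‖Φ z‖ < 1`. -/
theorem one_sub_norm_ge {Φ : ℂ → ℂ} (hΦ : IsAnalyticSelfMap Φ) {z : ℂ} (hz : z ∈ ball (0 : ℂ) 1) :
    (1 - ‖Φ 0‖) / 2 * (1 - ‖z‖) ≤ 1 - ‖Φ z‖ := by
  have hz1 : ‖z‖ < 1 := by simpa using hz
  obtain ⟨u, hu, huz⟩ : ∃ u : ℂ, ‖u‖ ≤ 1 ∧ u * Φ z = ‖Φ z‖ := by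
    by_cases h : Φ z = 0
    · exact ⟨0, by simp, by simp [h]⟩
    · have hn : ‖Φ z‖ ≠ 0 := by simpa using h
      refine ⟨‖Φ z‖ / Φ z, by simp [hn], by field_simp⟩
  set h : ℂ → ℂ := fun ζ => 1 - u * Φ ζ with hh
  have hd : DifferentiableOn ℂ h (ball 0 1) := (hΦ.1.const_mul u).const_sub 1
  have hlb : ∀ ζ ∈ ball (0 : ℂ) 1, 1 - ‖Φ ζ‖ ≤ (h ζ).re := by
    intro ζ hζ
    have h1 := Complex.re_le_norm (u * Φ ζ)
    rw [norm_mul] at h1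
    simp only [hh, Complex.sub_re, Complex.one_re]
    nlinarith [norm_nonneg (Φ ζ)]
  have key : ∀ R ∈ Ioo ‖z‖ 1, (1 - ‖Φ 0‖) / 2 * (R - ‖z‖) ≤ 1 - ‖Φ z‖ := by
    rintro R ⟨hzR, hR1⟩
    have hR : 0 < R := (norm_nonneg z).trans_lt hzR
    have hsub : closedBall (0 : ℂ) R ⊆ ball 0 1 := closedBall_subset_ball hR1
    have hw : z ∈ ball (0 : ℂ) R := by simpa using hzR
    have hD : DiffContOnCl ℂ h (ball 0 R) := (hd.mono hsub).diffContOnCl_ball subset_rfl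
    have hhc : ContinuousOn h (sphere 0 |R|) := by
      rw [abs_of_pos hR]
      exact hd.continuousOn.mono (sphere_subset_closedBall.trans hsub)
    have hk' : ContinuousOn (Complex.re ∘ herglotzRieszKernel 0 z) (sphere 0 |R|) :=
      Complex.continuous_re.comp_continuousOn (continuousOn_herglotzRieszKernel_sphere hw)
    have e1 := hD.circleAverage_re_herglotzRieszKernel_smul hw
    have e2 := (show DiffContOnCl ℂ h (ball 0 |R|) by rwa [abs_of_pos hR]).circleAverage
    have e3 := Complex.reCLM.circleAverage_comp_comm
      (f := (Complex.re ∘ herglotzRieszKernel 0 z) • h) (c := 0) (R := R)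
      ((hk'.smul hhc).circleIntegrable')
    have e4 := Complex.reCLM.circleAverage_comp_comm (f := h) (c := 0) (R := R)
      (hhc.circleIntegrable')
    rw [e1] at e3
    rw [e2] at e4
    have e5 : Real.circleAverage (((R - ‖z‖) / (R + ‖z‖)) • (Complex.reCLM ∘ h)) 0 R ≤
        Real.circleAverage (Complex.reCLM ∘ ((Complex.re ∘ herglotzRieszKernel 0 z) • h)) 0 R := by
      apply Real.circleAverage_mono
      · exact ((Complex.reCLM.continuous.comp_continuousOn hhc).const_smul _).circleIntegrable'
      · exact (Complex.reCLM.continuous.comp_continuousOn (hk'.smul hhc)).circleIntegrable'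
      · intro ζ hζ
        rw [abs_of_pos hR] at hζ
        have h6 := le_re_herglotzRieszKernel hζ hw
        have h7 : ‖Φ ζ‖ < 1 := by simpa using hΦ.2 (hsub (sphere_subset_closedBall hζ))
        have h8 := hlb ζ (hsub (sphere_subset_closedBall hζ))
        simp only [sub_zero] at h6
        simp only [Pi.smul_apply', Pi.smul_apply, Function.comp_apply, smul_eq_mul,
            herglotzRieszKernel_def, sub_zero, Complex.reCLM_apply, Complex.smul_re]
        exact mul_le_mul_of_nonneg_right h6 (by linarith)
    rw [Real.circleAverage_smul, e3, e4, smul_eq_mul] at e5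
    have h9 : (h z).re = 1 - ‖Φ z‖ := by simp [hh, huz]
    have h10 := hlb 0 (by simp)
    have h11 : ‖Φ 0‖ < 1 := by simpa using hΦ.2 (show (0:ℂ) ∈ ball 0 1 by simp)
    simp only [Complex.reCLM_apply, h9] at e5
    refine le_trans ?_ e5
    have h12 : (R - ‖z‖) / 2 ≤ (R - ‖z‖) / (R + ‖z‖) := by
      apply div_le_div_of_nonneg_left <;> linarith [norm_nonneg z]
    calc (1 - ‖Φ 0‖) / 2 * (R - ‖z‖) = (R - ‖z‖) / 2 * (1 - ‖Φ 0‖) := by ring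
      _ ≤ _ := mul_le_mul h12 h10 (by linarith) (by
        apply div_nonneg <;> linarith [norm_nonneg z])
  have hlim : Tendsto (fun R : ℝ => (1 - ‖Φ 0‖) / 2 * (R - ‖z‖)) (𝓝[<] 1)
      (𝓝 ((1 - ‖Φ 0‖) / 2 * (1 - ‖z‖))) := by
    apply tendsto_nhdsWithin_of_tendsto_nhds
    exact (Continuous.tendsto (by fun_prop) 1)
  exact le_of_tendsto hlim (by filter_upwards [Ioo_mem_nhdsLT hz1] with R hR using key R hR)
end

end BergmanSpace

/-- The measure `dA_α = (α + 1) (1 - |z|²) ^ α dA` on the open unit disc, where `dA` is area measure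
divided by `π`. It is a measure on `ℂ` that vanishes outside the disc. -/
noncomputable def bergmanMeasure (α : ℝ) : Measure ℂ :=
  (volume.restrict (ball (0 : ℂ) 1)).withDensity
    (fun z => ENNReal.ofReal ((α + 1) / Real.pi * (1 - ‖z‖ ^ 2) ^ α))

namespace BergmanSpace

/-! ### Integrals against the weighted area measure -/

section
variable {H : Type*} [NormedAddCommGroup H] [InnerProductSpace ℂ H]

/-- Polar coordinates. -/
theorem lintegral_bergmanMeasure (α : ℝ) {g : ℂ → ENNReal} (hg : Measurable g) :
    ∫⁻ z, g z ∂(bergmanMeasure α) = ∫⁻ r in Ioo (0 : ℝ) 1,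
      ENNReal.ofReal (r * ((α + 1) / Real.pi * (1 - r ^ 2) ^ α)) *
        ∫⁻ θ in Ioo (-Real.pi) Real.pi, g (circleMap 0 r θ) := by
  have hW : Measurable
      (fun z : ℂ => ENNReal.ofReal ((α + 1) / Real.pi * (1 - ‖z‖ ^ 2) ^ α)) := by fun_prop
  rw [bergmanMeasure, lintegral_withDensity_eq_lintegral_mul _ hW hg,
    ← lintegral_indicator measurableSet_ball, ← Complex.lintegral_comp_polarCoord_symm,
    polarCoord_target, Measure.volume_eq_prod, ← Measure.prod_restrict,
    lintegral_prod _ ?_, ← lintegral_indicator measurableSet_Ioi,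
    ← lintegral_indicator measurableSet_Ioo]
  · congr 1
    ext r
    by_cases h0 : 0 < r
    · rw [indicator_of_mem (show r ∈ Ioi (0 : ℝ) from h0)]
      by_cases h1 : r < 1
      · rw [indicator_of_mem (show r ∈ Ioo (0 : ℝ) 1 from ⟨h0, h1⟩),
          ← lintegral_const_mul _ (by fun_prop)]
        congr 1
        ext θ
        have e : Complex.polarCoord.symm (r, θ) = circleMap 0 r θ := by
          simp [Complex.polarCoord_symm_apply, circleMap, Complex.exp_mul_I]
        rw [e, indicator_of_mem (by simpa [abs_of_pos h0] using h1), ENNReal.ofReal_mul h0.le]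
        simp [abs_of_pos h0, mul_assoc]
      · rw [indicator_of_notMem (fun h => h1 h.2)]
        refine (lintegral_congr fun θ => ?_).trans lintegral_zero
        rw [indicator_of_notMem, smul_zero]
        simpa [abs_of_pos h0] using h1
    · rw [indicator_of_notMem (show r ∉ Ioi (0 : ℝ) from h0),
        indicator_of_notMem (fun h => h0 h.1)]
  · have : Measurable (fun p : ℝ × ℝ => Complex.polarCoord.symm p) := by
      simp_rw [Complex.polarCoord_symm_apply]; fun_prop
    have h2 := ((hW.mul hg).indicator (measurableSet_ball (x := (0 : ℂ)) (ε := 1))).comp this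
    exact ((by fun_prop : Measurable fun p : ℝ × ℝ => ENNReal.ofReal p.1).mul h2).aemeasurable

theorem lintegral_circle_eq {f : ℂ → H} (hf : ContinuousOn f (ball 0 1)) {r : ℝ}
    (hr : r ∈ Ioo (0 : ℝ) 1) :
    ∫⁻ θ in Ioo (-Real.pi) Real.pi, ‖f (circleMap 0 r θ)‖ₑ ^ 2 =
      ENNReal.ofReal (2 * Real.pi * Real.circleAverage (fun ζ => ‖f ζ‖ ^ 2) 0 r) := by
  have hpi := Real.pi_pos
  have hm : ∀ θ, circleMap 0 r θ ∈ ball (0 : ℂ) 1 := by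
    intro θ; simpa [abs_of_pos hr.1] using hr.2
  have hc : Continuous (fun θ => ‖f (circleMap 0 r θ)‖ ^ 2) := by
    refine Continuous.pow (Continuous.norm ?_) 2
    exact hf.comp_continuous (continuous_circleMap 0 r) hm
  have h1 : 2 * Real.pi * Real.circleAverage (fun ζ => ‖f ζ‖ ^ 2) 0 r =
      ∫ θ in Ioo (-Real.pi) Real.pi, ‖f (circleMap 0 r θ)‖ ^ 2 := by
    rw [Real.circleAverage_eq_integral_add (-Real.pi), smul_eq_mul, ← mul_assoc,
      mul_inv_cancel₀ (by positivity), one_mul,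
      intervalIntegral.integral_comp_add_right (fun θ => ‖f (circleMap 0 r θ)‖ ^ 2),
      intervalIntegral.integral_of_le (by linarith), integral_Ioc_eq_integral_Ioo]
    congr 3 <;> ring
  rw [h1, ofReal_integral_eq_lintegral_ofReal]
  · refine lintegral_congr fun θ => ?_
    rw [ENNReal.ofReal_pow (norm_nonneg _), ofReal_norm]
  · exact (hc.integrableOn_Icc (a := -Real.pi) (b := Real.pi)).mono_set Ioo_subset_Icc_self
  · exact Eventually.of_forall fun θ => by positivity

theorem measurable_enorm_sq {f : ℂ → H} (hf : ContinuousOn f (ball 0 1))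
    (h0 : ∀ z ∉ ball (0 : ℂ) 1, f z = 0) : Measurable (fun z => ‖f z‖ₑ ^ 2) := by
  classical
  have h1 : ContinuousOn (fun z => ‖f z‖ₑ ^ 2) (ball 0 1) :=
    (ENNReal.continuous_pow 2).comp_continuousOn hf.enorm
  have h2 := h1.measurable_piecewise (continuousOn_const (c := (0 : ENNReal)) (s := (ball (0 : ℂ) 1)ᶜ))
    measurableSet_ball
  convert h2 using 1
  ext z
  by_cases hz : z ∈ ball (0 : ℂ) 1
  · simp [piecewise_eq_of_mem _ _ _ hz]
  · simp [piecewise_eq_of_notMem _ _ _ hz, h0 z hz]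

theorem lintegral_comp_affine (F : ℝ → ENNReal) {k : ℝ} (hk : 0 < k) (b : ℝ) :
    ∫⁻ r, F (k * r + b) = ENNReal.ofReal k⁻¹ * ∫⁻ r, F r := by
  have h1 : ∫⁻ r, F (k * r + b) = ∫⁻ y, F (y + b) ∂(Measure.map (k * ·) volume) := by
    exact ((Homeomorph.mulLeft₀ k hk.ne').measurableEmbedding.lintegral_map
      (fun y => F (y + b))).symm
  rw [h1, Real.map_volume_mul_left hk.ne', lintegral_smul_measure, lintegral_add_right_eq_self,
    abs_of_pos (inv_pos.2 hk), smul_eq_mul]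

variable [CompleteSpace H]

/-- Composition with an analytic self-map of the disc is bounded in the `L²` norm. -/
theorem lintegral_comp_le (α : ℝ) (hα : -1 < α) {Φ : ℂ → ℂ} (hΦ : IsAnalyticSelfMap Φ) :
    ∃ C : ℝ, 0 ≤ C ∧ ∀ f : ℂ → H, DifferentiableOn ℂ f (ball 0 1) →
      (∀ z ∉ ball (0 : ℂ) 1, f z = 0) →
      ∫⁻ z, ‖(ball (0 : ℂ) 1).indicator (f ∘ Φ) z‖ₑ ^ 2 ∂(bergmanMeasure α) ≤
        ENNReal.ofReal C * ∫⁻ z, ‖f z‖ₑ ^ 2 ∂(bergmanMeasure α) := by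
  set c := ‖Φ 0‖ with hc
  have hc0 : 0 ≤ c := norm_nonneg _
  have hc1 : c < 1 := by simpa using hΦ.2 (show (0 : ℂ) ∈ ball 0 1 by simp)
  set k := (1 - c) / 4 with hk
  have hk0 : 0 < k := by rw [hk]; linarith
  have hpi := Real.pi_pos
  set W : ℝ → ℝ := fun r => r * ((α + 1) / Real.pi * (1 - r ^ 2) ^ α) with hW
  set C1 : ℝ := (2 / k) ^ |α| with hC1
  set K : ℝ := 8 / (3 * (1 - c)) with hK
  have hK0 : 0 ≤ K := by rw [hK]; apply div_nonneg <;> linarith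
  have hC10 : 0 ≤ C1 := by positivity
  refine ⟨C1 * K * k⁻¹, by positivity, fun f hf hf0 => ?_⟩
  have hfΦ : DifferentiableOn ℂ (f ∘ Φ) (ball 0 1) := hf.comp hΦ.1 hΦ.2
  have hind : ContinuousOn ((ball (0 : ℂ) 1).indicator (f ∘ Φ)) (ball 0 1) :=
    hfΦ.continuousOn.congr fun z hz => indicator_of_mem hz _
  rw [lintegral_bergmanMeasure α (measurable_enorm_sq hind fun z hz => indicator_of_notMem hz _),
    lintegral_bergmanMeasure α (measurable_enorm_sq hf.continuousOn hf0)]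
  set M : ℝ → ENNReal := fun r => ∫⁻ θ in Ioo (-Real.pi) Real.pi, ‖f (circleMap 0 r θ)‖ₑ ^ 2 with hM
  set F : ℝ → ENNReal := (Ioo (0 : ℝ) 1).indicator fun r => ENNReal.ofReal (W r) * M r with hF
  have hpt : ∀ r ∈ Ioo (0 : ℝ) 1, ENNReal.ofReal (W r) *
      ∫⁻ θ in Ioo (-Real.pi) Real.pi, ‖(ball (0 : ℂ) 1).indicator (f ∘ Φ) (circleMap 0 r θ)‖ₑ ^ 2 ≤
      ENNReal.ofReal (C1 * K) * F (k * r + (1 - k)) := by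
    intro r hr
    obtain ⟨hr0, hr1⟩ := hr
    set R := k * r + (1 - k) with hR
    have hRr : 1 - R = k * (1 - r) := by rw [hR]; ring
    have hR1 : R < 1 := by nlinarith
    have hRc : (3 + c) / 4 ≤ R := by rw [hR, hk]; nlinarith
    have hR0 : 0 < R := by linarith
    have hk1 : k ≤ 1 / 4 := by rw [hk]; linarith
    have hrR : r ≤ R := by nlinarith
    have hmap : ∀ z ∈ closedBall (0 : ℂ) r, Φ z ∈ ball (0 : ℂ) R := by
      intro z hz
      have hzr : ‖z‖ ≤ r := by simpa using hz
      have h1 := one_sub_norm_ge hΦ (z := z) (by simpa using hzr.trans_lt hr1)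
      have h2 : ‖Φ z‖ < R := by
        have : k * (1 - r) < (1 - c) / 2 * (1 - ‖z‖) := by
          rw [hk]; nlinarith
        linarith
      simpa using h2
    have hsub := circleAverage_comp_le hf hΦ hr0 hr1 hR1 hmap
    have hav : 0 ≤ Real.circleAverage (fun ζ => ‖f ζ‖ ^ 2) 0 R :=
      Real.circleAverage_nonneg_of_nonneg fun _ _ => by positivity
    have hKR : (R + c) / (R - c) ≤ K := by
      rw [hK, div_le_div_iff₀ (by linarith) (by linarith)]
      nlinarith
    have hWle : W r ≤ C1 * W R := by
      have hx : 0 < 1 - r ^ 2 := by nlinarith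
      have hy : 0 < 1 - R ^ 2 := by nlinarith
      have hyx : 1 - R ^ 2 ≤ 1 - r ^ 2 := by nlinarith
      have hxy : 1 - r ^ 2 ≤ 2 / k * (1 - R ^ 2) := by
        have : 2 / k * (1 - R ^ 2) = 2 * (1 - r) * (1 + R) := by
          have : 1 - R ^ 2 = k * (1 - r) * (1 + R) := by rw [← hRr]; ring
          rw [this]; field_simp
        rw [this]; nlinarith
      have hpow : (1 - r ^ 2) ^ α ≤ C1 * (1 - R ^ 2) ^ α := by
        rcases le_or_gt 0 α with h | h
        · rw [hC1, abs_of_nonneg h, ← Real.mul_rpow (by positivity) hy.le]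
          exact Real.rpow_le_rpow hx.le hxy h
        · have h1 : (1 - r ^ 2) ^ α ≤ (1 - R ^ 2) ^ α :=
            Real.rpow_le_rpow_of_nonpos hy hyx h.le
          have h2 : 1 ≤ C1 := by
            apply Real.one_le_rpow _ (abs_nonneg α)
            rw [le_div_iff₀ hk0]; linarith
          have h3 : 0 ≤ (1 - R ^ 2) ^ α := by positivity
          nlinarith
      have hco : 0 ≤ (α + 1) / Real.pi := by apply div_nonneg <;> linarith
      calc W r ≤ R * ((α + 1) / Real.pi * (C1 * (1 - R ^ 2) ^ α)) := by
            change r * _ ≤ _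
            gcongr
        _ = C1 * W R := by rw [hW]; ring
    have hWR : 0 ≤ W R := by
      have hy : 0 < 1 - R ^ 2 := by nlinarith
      have hco : 0 ≤ (α + 1) / Real.pi := by apply div_nonneg <;> linarith
      rw [hW]; positivity
    have hFR : F R = ENNReal.ofReal (W R) * M R :=
      indicator_of_mem (show R ∈ Ioo (0 : ℝ) 1 from ⟨hR0, hR1⟩) _
    have hMR : M R = ENNReal.ofReal (2 * Real.pi * Real.circleAverage (fun ζ => ‖f ζ‖ ^ 2) 0 R) :=
      lintegral_circle_eq hf.continuousOn ⟨hR0, hR1⟩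
    rw [hFR, hMR,
      lintegral_circle_eq hind (show r ∈ Ioo (0 : ℝ) 1 from ⟨hr0, hr1⟩)]
    have hcongr : Real.circleAverage
        (fun ζ => ‖(ball (0 : ℂ) 1).indicator (f ∘ Φ) ζ‖ ^ 2) 0 r =
        Real.circleAverage (fun ζ => ‖f (Φ ζ)‖ ^ 2) 0 r := by
      apply Real.circleAverage_congr_sphere
      intro ζ hζ
      rw [abs_of_pos hr0] at hζ
      have : ζ ∈ ball (0 : ℂ) 1 := closedBall_subset_ball hr1 (sphere_subset_closedBall hζ)
      simp only [indicator_of_mem this, Function.comp_apply]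
    rw [hcongr]
    calc ENNReal.ofReal (W r) * ENNReal.ofReal
          (2 * Real.pi * Real.circleAverage (fun ζ => ‖f (Φ ζ)‖ ^ 2) 0 r)
        ≤ ENNReal.ofReal (C1 * W R) * ENNReal.ofReal
          (2 * Real.pi * (K * Real.circleAverage (fun ζ => ‖f ζ‖ ^ 2) 0 R)) := by
          gcongr
          exact hsub.trans (mul_le_mul_of_nonneg_right hKR hav)
      _ = _ := by
          rw [← ENNReal.ofReal_mul (by positivity), ← ENNReal.ofReal_mul hWR,
            ← ENNReal.ofReal_mul (by positivity)]
          congr 1; ring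
  calc ∫⁻ r in Ioo (0 : ℝ) 1, ENNReal.ofReal (W r) *
        ∫⁻ θ in Ioo (-Real.pi) Real.pi, ‖(ball (0 : ℂ) 1).indicator (f ∘ Φ) (circleMap 0 r θ)‖ₑ ^ 2
      ≤ ∫⁻ r in Ioo (0 : ℝ) 1, ENNReal.ofReal (C1 * K) * F (k * r + (1 - k)) :=
        setLIntegral_mono' measurableSet_Ioo hpt
    _ ≤ ∫⁻ r, ENNReal.ofReal (C1 * K) * F (k * r + (1 - k)) := setLIntegral_le_lintegral _ _
    _ = ENNReal.ofReal (C1 * K) * (ENNReal.ofReal k⁻¹ * ∫⁻ r, F r) := by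
        rw [lintegral_const_mul' _ _ ENNReal.ofReal_ne_top, lintegral_comp_affine F hk0]
    _ = _ := by
        rw [← mul_assoc, ← ENNReal.ofReal_mul (by positivity), hF,
          lintegral_indicator measurableSet_Ioo]

/-- Point evaluations are bounded, uniformly on smaller discs. -/
theorem enorm_sq_le (α : ℝ) (hα : -1 < α) {s : ℝ} (hs0 : 0 ≤ s) (hs1 : s < 1) :
    ∃ A : ENNReal, A ≠ 0 ∧ ∀ f : ℂ → H, DifferentiableOn ℂ f (ball 0 1) →
      (∀ z ∉ ball (0 : ℂ) 1, f z = 0) → ∀ w : ℂ, ‖w‖ ≤ s →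
      ‖f w‖ₑ ^ 2 * A ≤ ∫⁻ z, ‖f z‖ₑ ^ 2 ∂(bergmanMeasure α) := by
  have hpi := Real.pi_pos
  set t := (1 + s) / 2 with ht
  have ht1 : t < 1 := by rw [ht]; linarith
  have ht0 : 0 < t := by rw [ht]; linarith
  set W : ℝ → ℝ := fun r => r * ((α + 1) / Real.pi * (1 - r ^ 2) ^ α) with hW
  have hWm : Measurable W := by rw [hW]; fun_prop
  set B := ∫⁻ r in Ioo t 1, ENNReal.ofReal (W r) with hB
  have hB0 : B ≠ 0 := by
    rw [hB, ← pos_iff_ne_zero, setLIntegral_pos_iff (by fun_prop)]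
    have : Ioo t 1 ⊆ Function.support (fun r => ENNReal.ofReal (W r)) := by
      intro r hr
      have h1 : 0 < 1 - r ^ 2 := by nlinarith [hr.1, hr.2]
      have h2 : 0 < r := ht0.trans hr.1
      have h3 : 0 < (α + 1) / Real.pi := by apply div_pos <;> linarith
      have : 0 < W r := by rw [hW]; positivity
      simpa using this
    rw [inter_eq_right.2 this]
    simpa using ht1
  refine ⟨ENNReal.ofReal (2 * Real.pi * ((1 - s) / 4)) * B, ?_, fun f hf hf0 w hw => ?_⟩
  · refine mul_ne_zero ?_ hB0
    have : 0 < 2 * Real.pi * ((1 - s) / 4) := by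
      have : 0 < 1 - s := by linarith
      positivity
    simpa using this
  rw [lintegral_bergmanMeasure α (measurable_enorm_sq hf.continuousOn hf0)]
  calc ‖f w‖ₑ ^ 2 * (ENNReal.ofReal (2 * Real.pi * ((1 - s) / 4)) * B)
      = ∫⁻ r in Ioo t 1, ENNReal.ofReal (W r) *
          (‖f w‖ₑ ^ 2 * ENNReal.ofReal (2 * Real.pi * ((1 - s) / 4))) := by
        rw [lintegral_mul_const _ (by fun_prop), ← hB]; ring
    _ ≤ ∫⁻ r in Ioo t 1, ENNReal.ofReal (W r) *
        ∫⁻ θ in Ioo (-Real.pi) Real.pi, ‖f (circleMap 0 r θ)‖ₑ ^ 2 := by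
        refine setLIntegral_mono' measurableSet_Ioo fun R hR => ?_
        have hR0 : 0 < R := ht0.trans hR.1
        have hRs : (1 - s) / 2 < R - s := by have := hR.1; rw [ht] at this; linarith
        gcongr
        rw [lintegral_circle_eq hf.continuousOn ⟨hR0, hR.2⟩, ← ofReal_norm,
          ← ENNReal.ofReal_pow (norm_nonneg _), ← ENNReal.ofReal_mul (by positivity)]
        apply ENNReal.ofReal_le_ofReal
        have hsub : closedBall (0 : ℂ) R ⊆ ball 0 1 := closedBall_subset_ball hR.2
        have hwR : w ∈ ball (0 : ℂ) R := by
          have : ‖w‖ < R := by linarith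
          simpa using this
        have h1 := norm_sq_le_poisson ((hf.mono hsub).diffContOnCl_ball subset_rfl) hwR
        have hfc : ContinuousOn (fun ζ => ‖f ζ‖ ^ 2) (sphere 0 |R|) := by
          rw [abs_of_pos hR0]
          exact ((hf.continuousOn.mono (sphere_subset_closedBall.trans hsub)).norm.pow 2)
        have h2 : Real.circleAverage
            ((Complex.re ∘ herglotzRieszKernel 0 w) • (fun ζ => ‖f ζ‖ ^ 2)) 0 R ≤
            Real.circleAverage ((4 / (1 - s)) • fun ζ => ‖f ζ‖ ^ 2) 0 R := by
          apply Real.circleAverage_mono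
          · exact (((Complex.continuous_re.comp_continuousOn
              (continuousOn_herglotzRieszKernel_sphere hwR))).smul hfc).circleIntegrable'
          · exact (hfc.const_smul _).circleIntegrable'
          · intro ζ hζ
            rw [abs_of_pos hR0] at hζ
            have h3 := re_herglotzRieszKernel_le hζ hwR
            simp only [sub_zero] at h3
            have h4 : (R + ‖w‖) / (R - ‖w‖) ≤ 4 / (1 - s) := by
              rw [div_le_div_iff₀ (by linarith) (by linarith)]
              nlinarith [hR.2]
            simp only [Pi.smul_apply', Pi.smul_apply, Function.comp_apply, smul_eq_mul,
              herglotzRieszKernel_def, sub_zero]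
            exact mul_le_mul_of_nonneg_right (h3.trans h4) (by positivity)
        rw [Real.circleAverage_smul] at h2
        have h5 := h1.trans h2
        have h6 : 0 < 1 - s := by linarith
        rw [smul_eq_mul, div_mul_eq_mul_div, le_div_iff₀ h6] at h5
        nlinarith
    _ ≤ _ := lintegral_mono_set (Ioo_subset_Ioo_left ht0.le)
end

end BergmanSpace

/-- The functions on the open unit disc that are analytic with values in `H` and square integrable
for `dA_α`. A function on the disc is represented by its extension by zero to `ℂ`. -/
def bergmanSubmodule (α : ℝ) (H : Type*) [NormedAddCommGroup H] [InnerProductSpace ℂ H] :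
    Submodule ℂ (ℂ → H) where
  carrier := {f | DifferentiableOn ℂ f (ball 0 1) ∧ (∀ z ∉ ball (0 : ℂ) 1, f z = 0) ∧
    MemLp f 2 (bergmanMeasure α)}
  zero_mem' := ⟨differentiableOn_const 0, fun _ _ => rfl, MemLp.zero⟩
  add_mem' := fun {f g} hf hg => ⟨hf.1.add hg.1,
    fun z hz => by simp [hf.2.1 z hz, hg.2.1 z hz], hf.2.2.add hg.2.2⟩
  smul_mem' := fun c f hf => ⟨hf.1.const_smul c,
    fun z hz => by simp [hf.2.1 z hz], hf.2.2.const_smul c⟩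

/-- The `H`-valued weighted Bergman space `A²_α(H)`. (A type of its own, so that it does not inherit
the topology of pointwise convergence.) -/
def BergmanSpace (α : ℝ) (H : Type*) [NormedAddCommGroup H] [InnerProductSpace ℂ H] : Type _ :=
  bergmanSubmodule α H

namespace BergmanSpace

section
variable {α : ℝ} {H : Type*} [NormedAddCommGroup H] [InnerProductSpace ℂ H]

instance : AddCommGroup (BergmanSpace α H) := inferInstanceAs (AddCommGroup (bergmanSubmodule α H))

instance : Module ℂ (BergmanSpace α H) := inferInstanceAs (Module ℂ (bergmanSubmodule α H))

instance : CoeFun (BergmanSpace α H) (fun _ => ℂ → H) := ⟨fun f => f.1⟩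

theorem coe_sub (f g : BergmanSpace α H) (z : ℂ) : (f - g) z = f z - g z := rfl

/-- The class of `f` in `L²(dA_α; H)`. -/
noncomputable def toLp (f : BergmanSpace α H) : Lp H 2 (bergmanMeasure α) := f.2.2.2.toLp f.1

theorem toLp_add (f g : BergmanSpace α H) : (f + g).toLp = f.toLp + g.toLp :=
  MemLp.toLp_add f.2.2.2 g.2.2.2

theorem toLp_sub (f g : BergmanSpace α H) : (f - g).toLp = f.toLp - g.toLp :=
  MemLp.toLp_sub f.2.2.2 g.2.2.2

theorem toLp_smul (c : ℂ) (f : BergmanSpace α H) : (c • f).toLp = c • f.toLp :=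
  MemLp.toLp_const_smul c f.2.2.2

theorem integral_inner_eq (f g : BergmanSpace α H) :
    ∫ z, inner ℂ (f z) (g z) ∂(bergmanMeasure α) = inner ℂ f.toLp g.toLp := by
  rw [L2.inner_def]
  apply integral_congr_ae
  filter_upwards [f.2.2.2.coeFn_toLp, g.2.2.2.coeFn_toLp] with z h1 h2
  simp only [toLp, h1, h2]

theorem enorm_toLp_sq (f : BergmanSpace α H) :
    ‖f.toLp‖ₑ ^ 2 = ∫⁻ z, ‖f z‖ₑ ^ 2 ∂(bergmanMeasure α) := by
  rw [toLp, Lp.enorm_toLp, eLpNorm_eq_lintegral_rpow_enorm_toReal (by simp) (by simp),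
    ← ENNReal.rpow_natCast, ← ENNReal.rpow_mul]
  simp

variable [CompleteSpace H]

theorem exists_norm_apply_le [Fact (-1 < α)] {s : ℝ} (hs0 : 0 ≤ s) (hs1 : s < 1) :
    ∃ C : ℝ, 0 ≤ C ∧ ∀ (f : BergmanSpace α H) (w : ℂ), ‖w‖ ≤ s → ‖f w‖ ≤ C * ‖f.toLp‖ := by
  obtain ⟨A, hA0, hA⟩ := enorm_sq_le (H := H) α Fact.out hs0 hs1
  refine ⟨√(A⁻¹).toReal, Real.sqrt_nonneg _, fun f w hw => ?_⟩
  have h1 := hA f.1 f.2.1 f.2.2.1 w hw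
  rw [← enorm_toLp_sq, ← ENNReal.le_div_iff_mul_le (Or.inl hA0) (Or.inr (by simp)),
    div_eq_mul_inv] at h1
  have h2 := ENNReal.toReal_mono (ENNReal.mul_ne_top (by simp) (by simpa using hA0)) h1
  simp only [ENNReal.toReal_mul, ENNReal.toReal_pow, toReal_enorm] at h2
  refine (pow_le_pow_iff_left₀ (norm_nonneg _) (by positivity) two_ne_zero).1 ?_
  rw [mul_pow, Real.sq_sqrt ENNReal.toReal_nonneg]
  linarith

end

section
variable {α : ℝ} [Fact (-1 < α)] {H : Type*} [NormedAddCommGroup H] [InnerProductSpace ℂ H]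
  [CompleteSpace H]

/-- The inner product `∫ ⟨f z, g z⟩ dA_α(z)`, in Mathlib's convention (linear in the second
argument). -/
noncomputable abbrev innerCore : InnerProductSpace.Core ℂ (BergmanSpace α H) where
  inner f g := ∫ z, inner ℂ (f z) (g z) ∂(bergmanMeasure α)
  conj_inner_symm f g := by
    simp only [integral_inner_eq, inner_conj_symm]
  re_inner_nonneg f := by
    rw [integral_inner_eq]; exact inner_self_nonneg
  add_left f g h := by
    simp only [integral_inner_eq, toLp_add, inner_add_left]
  smul_left f g c := by
    simp only [integral_inner_eq, toLp_smul, inner_smul_left]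
  definite f hf := by
    rw [integral_inner_eq, inner_self_eq_zero] at hf
    apply Subtype.ext
    ext w
    by_cases hw : w ∈ ball (0 : ℂ) 1
    · obtain ⟨C, -, hC⟩ := exists_norm_apply_le (α := α) (H := H) (norm_nonneg w)
        (by simpa using hw)
      have := hC f w le_rfl
      rw [hf, norm_zero, mul_zero] at this
      exact norm_le_zero_iff.1 this
    · exact f.2.2.1 w hw

noncomputable instance : NormedAddCommGroup (BergmanSpace α H) := innerCore.toNormedAddCommGroup

noncomputable instance : InnerProductSpace ℂ (BergmanSpace α H) := .ofCore innerCore.toCore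

theorem inner_def (f g : BergmanSpace α H) :
    inner ℂ f g = ∫ z, inner ℂ (f z) (g z) ∂(bergmanMeasure α) := rfl

theorem norm_eq (f : BergmanSpace α H) : ‖f‖ = ‖f.toLp‖ := by
  rw [norm_eq_sqrt_re_inner (𝕜 := ℂ), norm_eq_sqrt_re_inner (𝕜 := ℂ) f.toLp, inner_def,
    integral_inner_eq]

instance : CompleteSpace (BergmanSpace α H) := by
  refine Metric.complete_of_cauchySeq_tendsto fun u hu => ?_
  have hT : ∀ f g : BergmanSpace α H, dist f.toLp g.toLp = dist f g := fun f g => by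
    rw [dist_eq_norm, dist_eq_norm, norm_eq, toLp_sub]
  have hTu : CauchySeq fun n => (u n).toLp := by
    rw [Metric.cauchySeq_iff] at hu ⊢
    simpa only [hT] using hu
  obtain ⟨F, hF⟩ := cauchySeq_tendsto_of_complete hTu
  have hunif : ∀ s : ℝ, 0 ≤ s → s < 1 →
      UniformCauchySeqOn (fun n => (u n : ℂ → H)) atTop (closedBall (0 : ℂ) s) := by
    intro s hs0 hs1
    obtain ⟨C, hC0, hC⟩ := exists_norm_apply_le (α := α) (H := H) hs0 hs1
    rw [Metric.uniformCauchySeqOn_iff]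
    intro ε hε
    obtain ⟨N, hN⟩ := Metric.cauchySeq_iff.1 hu (ε / (C + 1)) (by positivity)
    refine ⟨N, fun m hm n hn w hw => ?_⟩
    have h1 := hC (u m - u n) w (by simpa using hw)
    have h2 := hN m hm n hn
    rw [dist_eq_norm, norm_eq, lt_div_iff₀ (by positivity)] at h2
    rw [dist_eq_norm, ← coe_sub]
    nlinarith [norm_nonneg (u m - u n).toLp]
  have hpt : ∀ z : ℂ, ∃ y : H, Tendsto (fun n => u n z) atTop (𝓝 y) := by
    intro z
    by_cases hz : z ∈ ball (0 : ℂ) 1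
    · exact cauchySeq_tendsto_of_complete
        ((hunif ‖z‖ (norm_nonneg z) (by simpa using hz)).cauchySeq (by simp))
    · exact ⟨0, tendsto_const_nhds.congr fun n => ((u n).2.2.1 z hz).symm⟩
  choose f hf using hpt
  have hdiff : DifferentiableOn ℂ f (ball 0 1) := by
    have : TendstoLocallyUniformlyOn (fun n => (u n : ℂ → H)) f atTop (ball (0 : ℂ) 1) := by
      rw [tendstoLocallyUniformlyOn_iff_forall_isCompact isOpen_ball]
      intro K hK hKc
      obtain ⟨s, hs0, hs1, hKs⟩ : ∃ s : ℝ, 0 ≤ s ∧ s < 1 ∧ K ⊆ closedBall (0 : ℂ) s := by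
        rcases K.eq_empty_or_nonempty with h | h
        · exact ⟨0, le_rfl, one_pos, by simp [h]⟩
        · obtain ⟨x, hx, hmax⟩ := hKc.exists_isMaxOn h continuous_norm.continuousOn
          exact ⟨‖x‖, norm_nonneg x, by simpa using hK hx, fun y hy => by simpa using hmax hy⟩
      exact ((hunif s hs0 hs1).tendstoUniformlyOn_of_tendsto fun x _ => hf x).mono hKs
    exact this.differentiableOn (Eventually.of_forall fun n => (u n).2.1) isOpen_ball
  have hae : F =ᵐ[bergmanMeasure α] f := by
    obtain ⟨ns, hns, hlim⟩ := (tendstoInMeasure_of_tendsto_Lp hF).exists_seq_tendsto_ae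
    have hall : ∀ᵐ z ∂(bergmanMeasure α), ∀ n, (u n).toLp z = u n z :=
      ae_all_iff.2 fun n => (u n).2.2.2.coeFn_toLp
    filter_upwards [hlim, hall] with z h1 h2
    simp only [h2] at h1
    exact tendsto_nhds_unique h1 ((hf z).comp hns.tendsto_atTop)
  let g : BergmanSpace α H := ⟨f, hdiff,
    fun z hz => tendsto_nhds_unique (hf z)
      (tendsto_const_nhds.congr fun n => ((u n).2.2.1 z hz).symm),
    (memLp_congr_ae hae).1 (Lp.memLp F)⟩
  have hg : g.toLp = F := by
    apply Lp.ext
    exact (g.2.2.2.coeFn_toLp).trans hae.symm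
  refine ⟨g, ?_⟩
  rw [tendsto_iff_dist_tendsto_zero] at hF ⊢
  rw [← hg] at hF
  simpa only [hT] using hF

theorem comp_mem {Φ : ℂ → ℂ} (hΦ : IsAnalyticSelfMap Φ) (f : BergmanSpace α H) :
    (ball (0 : ℂ) 1).indicator (f ∘ Φ) ∈ bergmanSubmodule α H := by
  have hd : DifferentiableOn ℂ ((ball (0 : ℂ) 1).indicator (f ∘ Φ)) (ball 0 1) :=
    (f.2.1.comp hΦ.1 hΦ.2).congr fun z hz => indicator_of_mem hz _
  refine ⟨hd, fun z hz => indicator_of_notMem hz _, ?_, ?_⟩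
  · have h1 := hd.continuousOn.aestronglyMeasurable (μ := volume) measurableSet_ball
    exact h1.mono_ac (withDensity_absolutelyContinuous _ _)
  · obtain ⟨C, hC0, hC⟩ := lintegral_comp_le (H := H) α Fact.out hΦ
    have h1 := hC f.1 f.2.1 f.2.2.1
    rw [eLpNorm_lt_top_iff_lintegral_rpow_enorm_lt_top (by simp) (by simp)]
    simp only [ENNReal.toReal_ofNat, ENNReal.rpow_ofNat]
    refine h1.trans_lt (ENNReal.mul_lt_top (by simp) ?_)
    rw [← enorm_toLp_sq]
    simp

/-- The linear map `f ↦ f ∘ Φ` on `A²_α(H)`. -/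
noncomputable def compLinear {Φ : ℂ → ℂ} (hΦ : IsAnalyticSelfMap Φ) :
    BergmanSpace α H →ₗ[ℂ] BergmanSpace α H where
  toFun f := ⟨(ball (0 : ℂ) 1).indicator (f ∘ Φ), comp_mem hΦ f⟩
  map_add' f g := Subtype.ext (indicator_add _ (f ∘ Φ) (g ∘ Φ))
  map_smul' c f := Subtype.ext (indicator_const_smul _ c (f ∘ Φ))

theorem exists_norm_compLinear_le {Φ : ℂ → ℂ} (hΦ : IsAnalyticSelfMap Φ) :
    ∃ C : ℝ, ∀ f : BergmanSpace α H, ‖compLinear hΦ f‖ ≤ C * ‖f‖ := by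
  obtain ⟨C, hC0, hC⟩ := lintegral_comp_le (H := H) α Fact.out hΦ
  refine ⟨√C, fun f => ?_⟩
  have h1 := hC f.1 f.2.1 f.2.2.1
  have h2 : ‖(compLinear hΦ f).toLp‖ₑ ^ 2 ≤ ENNReal.ofReal C * ‖f.toLp‖ₑ ^ 2 := by
    rw [enorm_toLp_sq, enorm_toLp_sq]; exact h1
  have h3 := ENNReal.toReal_mono (ENNReal.mul_ne_top (by simp) (by simp)) h2
  simp only [ENNReal.toReal_mul, ENNReal.toReal_pow, toReal_enorm, ENNReal.toReal_ofReal hC0] at h3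
  rw [norm_eq, norm_eq]
  refine (pow_le_pow_iff_left₀ (norm_nonneg _) (by positivity) two_ne_zero).1 ?_
  rw [mul_pow, Real.sq_sqrt hC0]
  exact h3

end

/-- The composition operator `C_Φ f = f ∘ Φ` as a bounded operator on `A²_α(H)`. -/
noncomputable def compOp (α : ℝ) [Fact (-1 < α)] (H : Type*) [NormedAddCommGroup H]
    [InnerProductSpace ℂ H] [CompleteSpace H] {Φ : ℂ → ℂ} (hΦ : IsAnalyticSelfMap Φ) :
    BergmanSpace α H →L[ℂ] BergmanSpace α H :=
  (compLinear hΦ).mkContinuousOfExistsBound (exists_norm_compLinear_le hΦ)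

theorem compOp_apply (α : ℝ) [Fact (-1 < α)] (H : Type*) [NormedAddCommGroup H]
    [InnerProductSpace ℂ H] [CompleteSpace H] {Φ : ℂ → ℂ} (hΦ : IsAnalyticSelfMap Φ)
    (f : BergmanSpace α H) {z : ℂ} (hz : z ∈ ball (0 : ℂ) 1) :
    compOp α H hΦ f z = f (Φ z) :=
  indicator_of_mem hz (f ∘ Φ)

end BergmanSpace

end

namespace BergmanSpace

open Metric MeasureTheory Set Filter Topology

/-! ### Integrals in polar coordinates -/

section
variable {α : ℝ}

/-! The weight is radial and powers of `z` are orthogonal on circles, so pairing `z ^ n • x` with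
`f` sees only the `n`-th Taylor coefficient of `f`: the pairing is a nonzero constant, depending on
`n` but not on `x` or `f`, times `⟨x, f⁽ⁿ⁾(0)⟩` (`exists_inner_monomial`). Since an analytic
function on the disc is the sum of its Taylor series, pairings with monomials determine elements of
the space (`ext_inner_monomial`).

If `Φ z = c * z`, then `C_Φ` multiplies the `n`-th Taylor coefficient by `c ^ n`. Composition with
`conj c * z` multiplies `z ^ n • x` by `conj c ^ n`, and the inner product, conjugate-linear on the
left, turns this into the same factor. So the two operators are adjoint.

Conversely, let `C_Φ^* = C_Ψ`; degrees 0 and 1 suffice. `C_Ψ` fixes constants, so `f ∘ Φ` and `f`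
have the same pairing with every constant, hence the same value at 0; taking `f = z • x` gives `Φ 0
= 0`. By the chain rule `f ∘ Φ` then has derivative `Φ'(0) • f'(0)` at 0, and pairing with `z • x`
gives `C_Ψ (z • x) = conj Φ'(0) • (z • x)`, that is, `Ψ z = conj Φ'(0) * z`. The relation is
symmetric in `Φ` and `Ψ`, so `Φ` is linear too. -/

theorem measurable_of_continuousOn_ball {E : Type*} [TopologicalSpace E] [MeasurableSpace E]
    [BorelSpace E] [Zero E] {g : ℂ → E} (hg : ContinuousOn g (ball 0 1))
    (h0 : ∀ z ∉ ball (0 : ℂ) 1, g z = 0) : Measurable g := by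
  classical
  have h2 := hg.measurable_piecewise
    (continuousOn_const (c := (0 : E)) (s := (ball (0 : ℂ) 1)ᶜ)) measurableSet_ball
  convert h2 using 1
  ext z
  by_cases hz : z ∈ ball (0 : ℂ) 1
  · simp [piecewise_eq_of_mem _ _ _ hz]
  · simp [piecewise_eq_of_notMem _ _ _ hz, h0 z hz]

/-- The density of `bergmanMeasure` in the radial variable with respect to circle averages. -/
noncomputable def radialWeight (α r : ℝ) : ℝ :=
  2 * Real.pi * (r * ((α + 1) / Real.pi * (1 - r ^ 2) ^ α))

theorem weight_nonneg (hα : -1 < α) {r : ℝ} (hr : |r| < 1) :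
    0 ≤ (α + 1) / Real.pi * (1 - r ^ 2) ^ α := by
  have h1 : r ^ 2 < 1 := by rwa [sq_lt_one_iff_abs_lt_one]
  have h2 : 0 ≤ (α + 1) / Real.pi := div_nonneg (by linarith) Real.pi_pos.le
  have h3 : 0 ≤ (1 - r ^ 2) ^ α := Real.rpow_nonneg (by linarith) _
  positivity

/-- Integrals over the disc are weighted integrals of circle averages. -/
theorem integral_bergmanMeasure (hα : -1 < α) {g : ℂ → ℂ} (hg : ContinuousOn g (ball 0 1))
    (h0 : ∀ z ∉ ball (0 : ℂ) 1, g z = 0) (hi : Integrable g (bergmanMeasure α)) :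
    ∫ z, g z ∂(bergmanMeasure α) =
      ∫ r in Ioo (0 : ℝ) 1, (radialWeight α r : ℂ) * Real.circleAverage g 0 r := by
  have hgm : Measurable g := measurable_of_continuousOn_ball hg h0
  have hpi := Real.pi_pos
  set w : ℂ → ℝ := fun z => (α + 1) / Real.pi * (1 - ‖z‖ ^ 2) ^ α with hw
  have hW : Measurable (fun z : ℂ => ENNReal.ofReal (w z)) := by fun_prop
  have hwm : Measurable w := by fun_prop
  have hae : ∀ z ∈ ball (0 : ℂ) 1, (ENNReal.ofReal (w z)).toReal • g z = w z • g z := by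
    intro z hz
    rw [ENNReal.toReal_ofReal (weight_nonneg hα (by simpa using hz))]
  -- Moving the density into the integrand turns everything into an integral over the whole plane.
  -- `G` vanishes outside the disc because `g` does, whatever the value of `w` there.
  set G : ℂ → ℂ := fun z => w z • g z with hG
  have hGm : Measurable G := hwm.smul hgm
  have hG0 : ∀ z ∉ ball (0 : ℂ) 1, G z = 0 := fun z hz => by simp [hG, h0 z hz]
  have hsupp : (ball (0 : ℂ) 1).indicator G = G :=
    indicator_eq_self.2 fun z hz => by_contra fun h => hz (hG0 z h)
  have hGi : Integrable G volume := by
    rw [bergmanMeasure, integrable_withDensity_iff_integrable_smul' hW (by simp)] at hi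
    have h1 : IntegrableOn G (ball 0 1) volume :=
      Integrable.congr hi (by
        filter_upwards [ae_restrict_mem measurableSet_ball] with z hz using hae z hz)
    rwa [← integrable_indicator_iff measurableSet_ball, hsupp] at h1
  have h1 : ∫ z, g z ∂(bergmanMeasure α) = ∫ z, G z := by
    rw [bergmanMeasure, integral_withDensity_eq_integral_toReal_smul hW (by simp),
      setIntegral_congr_fun measurableSet_ball hae, ← integral_indicator measurableSet_ball, hsupp]
  have hms : Measurable (fun p : ℝ × ℝ => Complex.polarCoord.symm p) := by
    simp_rw [Complex.polarCoord_symm_apply]; fun_prop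
  -- Fubini needs integrability in polar coordinates; it comes from applying the change of variables
  -- for `∫⁻` to `‖G‖ₑ`, the Jacobian `p.1` being positive on the target.
  have hint : IntegrableOn (fun p : ℝ × ℝ => p.1 • G (Complex.polarCoord.symm p))
      polarCoord.target := by
    refine ⟨(measurable_fst.smul (hGm.comp hms)).aestronglyMeasurable, ?_⟩
    have h2 := Complex.lintegral_comp_polarCoord_symm (fun z => ‖G z‖ₑ)
    have h3 := hGi.2
    rw [HasFiniteIntegral, ← h2] at h3
    refine lt_of_eq_of_lt (setLIntegral_congr_fun ?_ fun p hp => ?_) h3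
    · exact polarCoord.open_target.measurableSet
    · have : 0 < p.1 := hp.1
      simp only [enorm_smul, smul_eq_mul, Real.enorm_eq_ofReal this.le]
  rw [h1, ← Complex.integral_comp_polarCoord_symm]
  rw [polarCoord_target, Measure.volume_eq_prod] at *
  rw [setIntegral_prod _ hint, ← integral_indicator measurableSet_Ioi,
    ← integral_indicator measurableSet_Ioo]
  congr 1
  ext r
  have e : ∀ θ, Complex.polarCoord.symm (r, θ) = circleMap 0 r θ := fun θ => by
    simp [Complex.polarCoord_symm_apply, circleMap, Complex.exp_mul_I]
  by_cases hr0 : 0 < r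
  · rw [indicator_of_mem (show r ∈ Ioi (0 : ℝ) from hr0)]
    simp only [e]
    by_cases hr1 : r < 1
    · rw [indicator_of_mem (show r ∈ Ioo (0 : ℝ) 1 from ⟨hr0, hr1⟩),
        -- Circle averages run over `[0, 2π]`, polar coordinates over `(-π, π)`: shift by `-π`.
        Real.circleAverage_eq_integral_add (-Real.pi),
        intervalIntegral.integral_comp_add_right (fun θ => g (circleMap 0 r θ)),
        intervalIntegral.integral_of_le (by linarith), integral_Ioc_eq_integral_Ioo]
      have e2 : Ioo (0 + -Real.pi) (2 * Real.pi + -Real.pi) = Ioo (-Real.pi) Real.pi := by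
        congr 1 <;> ring
      rw [e2, integral_smul]
      have e3 : ∀ θ, G (circleMap 0 r θ) =
          ((α + 1) / Real.pi * (1 - r ^ 2) ^ α) • g (circleMap 0 r θ) := fun θ => by
        simp [hG, hw, abs_of_pos hr0]
      simp only [e3]
      rw [integral_smul, radialWeight]
      simp only [Complex.real_smul]
      have : (Real.pi : ℂ) ≠ 0 := by exact_mod_cast hpi.ne'
      push_cast
      field_simp
    · rw [indicator_of_notMem (fun h => hr1 h.2)]
      refine (integral_congr_ae (Eventually.of_forall fun θ => ?_)).trans (integral_zero _ _)
      change r • G (circleMap 0 r θ) = 0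
      rw [hG0, smul_zero]
      simpa [abs_of_pos hr0] using hr1
  · rw [indicator_of_notMem (show r ∉ Ioi (0 : ℝ) from hr0),
      indicator_of_notMem (fun h => hr0 h.1)]

/-- Finiteness puts bounded analytic functions, in particular the monomials, into the space. -/
theorem isFiniteMeasure_bergmanMeasure (hα : -1 < α) : IsFiniteMeasure (bergmanMeasure α) := by
  refine ⟨?_⟩
  have h1 := lintegral_bergmanMeasure α (g := fun _ => 1) measurable_const
  rw [lintegral_one] at h1
  rw [h1]
  simp only [lintegral_one, Measure.restrict_apply_univ, Real.volume_Ioo]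
  rw [lintegral_mul_const' _ _ ENNReal.ofReal_ne_top]
  refine ENNReal.mul_lt_top ?_ ENNReal.ofReal_lt_top
  -- Factor `1 - r ^ 2 = (1 + r) * (1 - r)`. The first factor lies between 1 and 2, so its power is
  -- at most `2 ^ |α|` for either sign of `α`; the power of the second is integrable up to `r = 1`
  -- exactly because `α > -1`.
  have h2 : IntegrableOn (fun r : ℝ => (α + 1) / Real.pi * 2 ^ |α| * (1 - r) ^ α) (Ioo 0 1) := by
    have h3 := (intervalIntegral.intervalIntegrable_rpow' (a := 0) (b := 1) hα).comp_sub_left 1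
    simp only [sub_zero, sub_self] at h3
    exact ((intervalIntegrable_iff_integrableOn_Ioo_of_le zero_le_one).1 h3.symm).const_mul _
  refine lt_of_le_of_lt (setLIntegral_mono' measurableSet_Ioo fun r hr => ?_) h2.lintegral_lt_top
  apply ENNReal.ofReal_le_ofReal
  obtain ⟨hr0, hr1⟩ := hr
  have h4 : 0 ≤ (α + 1) / Real.pi := div_nonneg (by linarith) Real.pi_pos.le
  have h5 : (1 - r ^ 2) ^ α = (1 + r) ^ α * (1 - r) ^ α := by
    rw [← Real.mul_rpow (by linarith) (by linarith)]; congr 1; ring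
  have h6 : (1 + r) ^ α ≤ 2 ^ |α| :=
    (Real.rpow_le_rpow_of_exponent_le (by linarith) (le_abs_self α)).trans
      (Real.rpow_le_rpow (by linarith) (by linarith) (abs_nonneg α))
  have h7 : 0 ≤ (1 - r) ^ α := Real.rpow_nonneg (by linarith) _
  have h8 : 0 ≤ (1 + r) ^ α := Real.rpow_nonneg (by linarith) _
  calc r * ((α + 1) / Real.pi * (1 - r ^ 2) ^ α)
      ≤ 1 * ((α + 1) / Real.pi * ((1 + r) ^ α * (1 - r) ^ α)) := by rw [h5]; gcongr
    _ ≤ (α + 1) / Real.pi * 2 ^ |α| * (1 - r) ^ α := by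
      rw [one_mul, ← mul_assoc]; gcongr

end

/-! ### Monomials -/

section
variable {H : Type*} [NormedAddCommGroup H] [InnerProductSpace ℂ H]

theorem differentiable_pow_smul (n : ℕ) (x : H) : Differentiable ℂ fun z : ℂ => z ^ n • x := by
  fun_prop

theorem indicator_pow_smul_mem {α : ℝ} (hα : -1 < α) (n : ℕ) (x : H) :
    (ball (0 : ℂ) 1).indicator (fun z => z ^ n • x) ∈ bergmanSubmodule α H := by
  have := isFiniteMeasure_bergmanMeasure hα
  refine ⟨(differentiable_pow_smul n x).differentiableOn.congr fun z hz => indicator_of_mem hz _,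
    fun z hz => indicator_of_notMem hz _, MemLp.of_bound ?_ ‖x‖ (Eventually.of_forall fun z => ?_)⟩
  · exact (differentiable_pow_smul n x).continuous.aestronglyMeasurable.indicator measurableSet_ball
  · by_cases hz : z ∈ ball (0 : ℂ) 1
    · rw [indicator_of_mem hz, norm_smul, norm_pow]
      exact mul_le_of_le_one_left (norm_nonneg x)
        (pow_le_one₀ (norm_nonneg z) (by simpa using (mem_ball_zero_iff.1 hz).le))
    · rw [indicator_of_notMem hz, norm_zero]
      exact norm_nonneg x

/-- The function `z ↦ z ^ n • x` in `A²_α(H)`. -/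
noncomputable def monomial (α : ℝ) [Fact (-1 < α)] (n : ℕ) (x : H) : BergmanSpace α H :=
  ⟨(ball (0 : ℂ) 1).indicator (fun z => z ^ n • x), indicator_pow_smul_mem Fact.out n x⟩

theorem monomial_apply (α : ℝ) [Fact (-1 < α)] (n : ℕ) (x : H) {z : ℂ} (hz : z ∈ ball (0 : ℂ) 1) :
    monomial α n x z = z ^ n • x :=
  indicator_of_mem hz fun z => z ^ n • x

variable {α : ℝ}

theorem ext_ball {f g : BergmanSpace α H} (h : ∀ z ∈ ball (0 : ℂ) 1, f z = g z) : f = g := by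
  apply Subtype.ext
  ext z
  by_cases hz : z ∈ ball (0 : ℂ) 1
  · exact h z hz
  · exact (f.2.2.1 z hz).trans (g.2.2.1 z hz).symm

theorem coe_smul (c : ℂ) (f : BergmanSpace α H) (z : ℂ) : (c • f) z = c • f z := rfl

variable [CompleteSpace H]

/-- On `|z| = r` the conjugate of `z ^ n` is `r ^ (2 * n) * (z ^ n)⁻¹`, so the average is Cauchy's
formula for the `n`-th derivative paired with `x`. -/
theorem circleAverage_inner_pow_smul {f : ℂ → H} (hf : DifferentiableOn ℂ f (ball 0 1)) (n : ℕ)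
    (x : H) {r : ℝ} (hr : r ∈ Ioo (0 : ℝ) 1) :
    Real.circleAverage (fun z => inner ℂ (z ^ n • x) (f z)) 0 r =
      (r : ℂ) ^ (2 * n) / n.factorial * inner ℂ x (iteratedDeriv n f 0) := by
  obtain ⟨hr0, hr1⟩ := hr
  have hrC : (r : ℂ) ≠ 0 := by exact_mod_cast hr0.ne'
  have hsub : closedBall (0 : ℂ) r ⊆ ball 0 1 := closedBall_subset_ball hr1
  have hd : DiffContOnCl ℂ f (ball 0 r) := (hf.mono hsub).diffContOnCl_ball subset_rfl
  have h1 := hd.circleIntegral_one_div_sub_center_pow_smul hr0 n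
  have h2 : Real.circleAverage (fun z => (z ^ n)⁻¹ • f z) 0 r =
      ((n.factorial : ℂ)⁻¹) • iteratedDeriv n f 0 := by
    rw [Real.circleAverage_eq_circleIntegral hr0.ne']
    -- An average is a contour integral against `dz / z`, which supplies the extra power in Cauchy's
    -- formula.
    have : ∀ z : ℂ, (z - 0)⁻¹ • (z ^ n)⁻¹ • f z = (1 / (z - 0) ^ (n + 1)) • f z := fun z => by
      rw [smul_smul, sub_zero, ← mul_inv, one_div, pow_succ']
    simp only [this, h1, smul_smul]
    congr 1
    have := Complex.two_pi_I_ne_zero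
    field_simp
  -- A fixed linear functional can be pulled out of the average; it is taken over `ℝ` because the
  -- average is a real-variable integral.
  set L : H →L[ℝ] ℂ := ((r : ℂ) ^ (2 * n) • innerSL ℂ x).restrictScalars ℝ with hL
  have hci : CircleIntegrable (fun z => (z ^ n)⁻¹ • f z) 0 r := by
    apply ContinuousOn.circleIntegrable'
    rw [abs_of_pos hr0]
    refine ContinuousOn.smul (ContinuousOn.inv₀ (by fun_prop) fun z hz => ?_)
      (hf.continuousOn.mono (sphere_subset_closedBall.trans hsub))
    exact pow_ne_zero n (ne_of_mem_sphere hz hr0.ne')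
  have h3 := L.circleAverage_comp_comm hci
  rw [h2] at h3
  have h4 : Real.circleAverage (fun z => inner ℂ (z ^ n • x) (f z)) 0 r =
      Real.circleAverage (L ∘ fun z => (z ^ n)⁻¹ • f z) 0 r := by
    apply Real.circleAverage_congr_sphere
    intro z hz
    rw [abs_of_pos hr0] at hz
    have hz0 : z ≠ 0 := ne_of_mem_sphere hz hr0.ne'
    have hzr : ‖z‖ = r := by simpa using hz
    have hzz : (starRingEnd ℂ) z * z = (r : ℂ) ^ 2 := by
      rw [Complex.conj_mul', hzr]
    simp only [hL, Function.comp_apply, ContinuousLinearMap.coe_restrictScalars',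
      smul_apply, innerSL_apply_apply, smul_eq_mul, inner_smul_left,
      inner_smul_right, map_pow]
    rw [pow_mul, ← hzz, mul_pow]
    field_simp
  rw [h4, h3]
  simp only [hL, ContinuousLinearMap.coe_restrictScalars',
      smul_apply, innerSL_apply_apply, smul_eq_mul, inner_smul_right]
  ring

/-- The inner product with a monomial is a multiple of a Taylor coefficient. -/
theorem exists_inner_monomial [Fact (-1 < α)] [Nontrivial H] (n : ℕ) :
    ∃ w : ℂ, w ≠ 0 ∧ ∀ (x : H) (f : BergmanSpace α H),
      inner ℂ (monomial α n x) f = w * inner ℂ x (iteratedDeriv n f 0) := by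
  have key : ∀ (x : H) (f : BergmanSpace α H), inner ℂ (monomial α n x) f =
      (∫ r in Ioo (0 : ℝ) 1, (radialWeight α r : ℂ) * ((r : ℂ) ^ (2 * n) / n.factorial)) *
        inner ℂ x (iteratedDeriv n f 0) := by
    intro x f
    rw [inner_def, integral_bergmanMeasure Fact.out, ← integral_mul_const]
    · refine setIntegral_congr_fun measurableSet_Ioo fun r hr => ?_
      rw [mul_assoc, ← circleAverage_inner_pow_smul f.2.1 n x hr]
      congr 1
      apply Real.circleAverage_congr_sphere
      intro z hz
      rw [abs_of_pos hr.1] at hz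
      change inner ℂ (monomial α n x z) _ = _
      rw [monomial_apply]
      exact closedBall_subset_ball hr.2 (sphere_subset_closedBall hz)
    · exact (monomial α n x).2.1.continuousOn.inner f.2.1.continuousOn
    · intro z hz
      rw [f.2.2.1 z hz, inner_zero_right]
    · refine (L2.integrable_inner (𝕜 := ℂ) (monomial α n x).toLp f.toLp).congr ?_
      filter_upwards [(monomial α n x).2.2.2.coeFn_toLp, f.2.2.2.coeFn_toLp] with z h1 h2
      simp only [toLp, h1, h2]
  -- The radial integral need not be evaluated: if it were 0, then `z ^ n • x` with `x ≠ 0` would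
  -- have norm 0, contradicting its nonzero value at `1 / 2`.
  refine ⟨_, fun h => ?_, key⟩
  obtain ⟨x, hx⟩ := exists_ne (0 : H)
  have h1 := key x (monomial α n x)
  rw [h, zero_mul, inner_self_eq_zero] at h1
  have hz : (1 / 2 : ℂ) ∈ ball (0 : ℂ) 1 := by simp; norm_num
  have h2 := monomial_apply α n x hz
  rw [h1] at h2
  exact smul_ne_zero (pow_ne_zero n (by norm_num)) hx h2.symm

/-- Equal pairings give equal derivatives of all orders at 0, and the Taylor series at 0 converges
to the function on the whole disc. -/
theorem ext_inner_monomial [Fact (-1 < α)] [Nontrivial H] {f g : BergmanSpace α H}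
    (h : ∀ (n : ℕ) (x : H), inner ℂ (monomial α n x) f = inner ℂ (monomial α n x) g) : f = g := by
  refine ext_ball fun z hz => ?_
  have hn : ∀ n, iteratedDeriv n f 0 = iteratedDeriv n g 0 := by
    intro n
    obtain ⟨w, hw, hwx⟩ := exists_inner_monomial (α := α) (H := H) n
    refine ext_inner_left ℂ fun x => mul_left_cancel₀ hw ?_
    rw [← hwx, ← hwx, h]
  rw [← Complex.taylorSeries_eq_on_ball f.2.1 hz, ← Complex.taylorSeries_eq_on_ball g.2.1 hz]
  exact tsum_congr fun n => by rw [hn]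

end

/-! ### Adjoints of composition operators -/

section
variable {α : ℝ} [Fact (-1 < α)] {H : Type*} [NormedAddCommGroup H] [InnerProductSpace ℂ H]
  [CompleteSpace H]

theorem compOp_monomial_of_eq_mul {Ψ : ℂ → ℂ} (hΨ : IsAnalyticSelfMap Ψ) {c : ℂ}
    (h : ∀ z ∈ ball (0 : ℂ) 1, Ψ z = c * z) (n : ℕ) (x : H) :
    compOp α H hΨ (monomial α n x) = c ^ n • monomial α n x := by
  refine ext_ball fun z hz => ?_
  rw [compOp_apply _ _ _ _ hz, monomial_apply _ _ _ (hΨ.2 hz), coe_smul, monomial_apply _ _ _ hz,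
    h z hz, mul_pow, smul_smul]

theorem iteratedDeriv_compOp_of_eq_mul {Φ : ℂ → ℂ} (hΦ : IsAnalyticSelfMap Φ) {c : ℂ}
    (h : ∀ z ∈ ball (0 : ℂ) 1, Φ z = c * z) (n : ℕ) (f : BergmanSpace α H) :
    iteratedDeriv n (compOp α H hΦ f) 0 = c ^ n • iteratedDeriv n f 0 := by
  have h0 : (0 : ℂ) ∈ ball (0 : ℂ) 1 := by simp
  have hm : MapsTo (fun z => c * z) (ball (0 : ℂ) 1) (ball 0 1) := fun z hz => by
    simpa only [h z hz] using hΦ.2 hz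
  have h1 := iteratedDerivWithin_comp_const_smul (n := n) h0 isOpen_ball.uniqueDiffOn
    (f.2.1.contDiffOn isOpen_ball) c hm
  rw [iteratedDerivWithin_of_isOpen isOpen_ball h0, mul_zero,
    iteratedDerivWithin_of_isOpen isOpen_ball h0] at h1
  rw [← h1]
  refine Filter.EventuallyEq.iteratedDeriv_eq n ?_
  filter_upwards [isOpen_ball.mem_nhds h0] with z hz
  rw [compOp_apply _ _ _ _ hz, h z hz]

variable [Nontrivial H]

theorem adjoint_compOp_of_eq_mul {Φ Ψ : ℂ → ℂ} (hΦ : IsAnalyticSelfMap Φ)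
    (hΨ : IsAnalyticSelfMap Ψ) {c : ℂ} (h : ∀ z ∈ ball (0 : ℂ) 1, Φ z = c * z)
    (h' : ∀ z ∈ ball (0 : ℂ) 1, Ψ z = starRingEnd ℂ c * z) :
    ContinuousLinearMap.adjoint (compOp α H hΦ) = compOp α H hΨ := by
  -- The goal becomes `C_Φ = C_Ψ^*`, so that, tested against monomials, `C_Ψ` acts on the monomial
  -- and `C_Φ` on the Taylor coefficients of `f`.
  rw [← ContinuousLinearMap.adjoint_adjoint (compOp α H hΨ)]
  congr 1
  ext1 f
  refine ext_inner_monomial fun n x => ?_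
  obtain ⟨w, -, hw⟩ := exists_inner_monomial (α := α) (H := H) n
  rw [ContinuousLinearMap.adjoint_inner_right, compOp_monomial_of_eq_mul hΨ h', inner_smul_left, hw,
    hw, iteratedDeriv_compOp_of_eq_mul hΦ h, inner_smul_right, map_pow, Complex.conj_conj]
  ring

/-- Constants are fixed by every composition operator, and pairing with them is evaluation at 0.
Testing on `z • x` compares `0` with `Φ 0 • x`. -/
theorem apply_zero_of_adjoint_compOp {Φ Ψ : ℂ → ℂ} (hΦ : IsAnalyticSelfMap Φ)
    (hΨ : IsAnalyticSelfMap Ψ)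
    (h : ContinuousLinearMap.adjoint (compOp α H hΦ) = compOp α H hΨ) : Φ 0 = 0 := by
  have h0 : (0 : ℂ) ∈ ball (0 : ℂ) 1 := by simp
  obtain ⟨x, hx⟩ := exists_ne (0 : H)
  obtain ⟨w, hw0, hw⟩ := exists_inner_monomial (α := α) (H := H) 0
  have h1 : compOp α H hΨ (monomial α 0 x) = monomial α 0 x := by
    refine ext_ball fun z hz => ?_
    rw [compOp_apply _ _ _ _ hz, monomial_apply _ _ _ hz, monomial_apply _ _ _ (hΨ.2 hz), pow_zero,
      pow_zero]
  have h2 := ContinuousLinearMap.adjoint_inner_left (compOp α H hΦ) (monomial α 1 x)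
    (monomial α 0 x)
  rw [h, h1, hw, hw, iteratedDeriv_zero, iteratedDeriv_zero, compOp_apply _ _ _ _ h0,
    monomial_apply _ _ _ h0, monomial_apply _ _ _ (hΦ.2 h0)] at h2
  have h3 : inner ℂ x x ≠ 0 := inner_self_ne_zero.2 hx
  simpa [inner_smul_right, hw0, h3, -inner_self_eq_norm_sq_to_K, eq_comm] using h2

/-- Degree 1 alone determines `Ψ`, since `C_Ψ (z • x)` is `Ψ z • x` and `x ≠ 0` can be cancelled. -/
theorem eq_conj_deriv_mul_of_adjoint_compOp {Φ Ψ : ℂ → ℂ} (hΦ : IsAnalyticSelfMap Φ)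
    (hΨ : IsAnalyticSelfMap Ψ) (h : ContinuousLinearMap.adjoint (compOp α H hΦ) = compOp α H hΨ) :
    ∀ z ∈ ball (0 : ℂ) 1, Ψ z = starRingEnd ℂ (deriv Φ 0) * z := by
  have h0 : (0 : ℂ) ∈ ball (0 : ℂ) 1 := by simp
  have hΦ0 := apply_zero_of_adjoint_compOp hΦ hΨ h
  obtain ⟨x, hx⟩ := exists_ne (0 : H)
  obtain ⟨w, -, hw⟩ := exists_inner_monomial (α := α) (H := H) 1
  -- Because `Φ 0 = 0`, the chain rule involves `f` only through its derivative at 0.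
  have hd : ∀ f : BergmanSpace α H, deriv (compOp α H hΦ f) 0 = deriv Φ 0 • deriv f 0 := by
    intro f
    have h1 : (compOp α H hΦ f : ℂ → H) =ᶠ[𝓝 0] f.1 ∘ Φ := by
      filter_upwards [isOpen_ball.mem_nhds h0] with z hz
      rw [compOp_apply _ _ _ _ hz]; rfl
    rw [h1.deriv_eq, deriv.scomp, hΦ0]
    · rw [hΦ0]; exact f.2.1.differentiableAt (isOpen_ball.mem_nhds h0)
    · exact hΦ.1.differentiableAt (isOpen_ball.mem_nhds h0)
  have h1 : compOp α H hΨ (monomial α 1 x) = starRingEnd ℂ (deriv Φ 0) • monomial α 1 x := by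
    refine ext_inner_right ℂ fun f => ?_
    rw [← h, ContinuousLinearMap.adjoint_inner_left, hw, inner_smul_left, hw, iteratedDeriv_one,
      iteratedDeriv_one, hd, inner_smul_right, Complex.conj_conj]
    ring
  intro z hz
  have h2 : compOp α H hΨ (monomial α 1 x) z =
      (starRingEnd ℂ (deriv Φ 0) • monomial α 1 x : BergmanSpace α H) z := by rw [h1]
  rw [compOp_apply _ _ _ _ hz, coe_smul, monomial_apply _ _ _ hz, monomial_apply _ _ _ (hΨ.2 hz),
    pow_one, pow_one, smul_smul] at h2
  exact smul_left_injective ℂ hx h2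

end

/-! ### Linear self-maps of the disc -/

theorem norm_le_one_of_eq_mul {Φ : ℂ → ℂ} (hΦ : IsAnalyticSelfMap Φ) {c : ℂ}
    (h : ∀ z ∈ ball (0 : ℂ) 1, Φ z = c * z) : ‖c‖ ≤ 1 := by
  by_contra! hc
  have hc0 : c ≠ 0 := fun h => by simp [h] at hc; linarith
  -- If `‖c‖ > 1`, this point of the disc would be sent to the boundary point 1.
  have hz : c⁻¹ ∈ ball (0 : ℂ) 1 := by simpa using inv_lt_one_of_one_lt₀ hc
  have h1 := hΦ.2 hz
  rw [h _ hz, mul_inv_cancel₀ hc0] at h1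
  simp at h1

theorem isAnalyticSelfMap_const_mul {c : ℂ} (hc : ‖c‖ ≤ 1) : IsAnalyticSelfMap fun z => c * z := by
  refine ⟨by fun_prop, fun z hz => ?_⟩
  rw [mem_ball_zero_iff] at hz ⊢
  rw [norm_mul]
  exact (mul_le_of_le_one_left (norm_nonneg z) hc).trans_lt hz

end BergmanSpace

/-! ### The characterization -/

theorem mainTheorem4 {H : Type*} [NormedAddCommGroup H] [InnerProductSpace ℂ H] [CompleteSpace H]
    [Nontrivial H] (α : ℝ) [Fact (-1 < α)] (Φ : ℂ → ℂ) (hΦ : IsAnalyticSelfMap Φ) :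
    ((∃ (Ψ : ℂ → ℂ) (hΨ : IsAnalyticSelfMap Ψ),
        ContinuousLinearMap.adjoint (BergmanSpace.compOp α H hΦ) = BergmanSpace.compOp α H hΨ) ↔
      ∃ c : ℂ, ‖c‖ ≤ 1 ∧ ∀ z ∈ Metric.ball (0 : ℂ) 1, Φ z = c * z) ∧
    (∀ c : ℂ, ‖c‖ ≤ 1 → (∀ z ∈ Metric.ball (0 : ℂ) 1, Φ z = c * z) →
      ∀ (Ψ : ℂ → ℂ) (hΨ : IsAnalyticSelfMap Ψ),
        ContinuousLinearMap.adjoint (BergmanSpace.compOp α H hΦ) = BergmanSpace.compOp α H hΨ ↔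
          ∀ z ∈ Metric.ball (0 : ℂ) 1, Ψ z = starRingEnd ℂ c * z) := by
  refine ⟨⟨?_, ?_⟩, ?_⟩
  · rintro ⟨Ψ, hΨ, h⟩
    -- The lemma describes the symbol of the adjoint, so the roles are swapped to get a formula for
    -- `Φ`; the resulting constant is `conj Ψ'(0)`.
    have h' : ContinuousLinearMap.adjoint (BergmanSpace.compOp α H hΨ) =
        BergmanSpace.compOp α H hΦ := by
      rw [← h, ContinuousLinearMap.adjoint_adjoint]
    have h1 := BergmanSpace.eq_conj_deriv_mul_of_adjoint_compOp hΨ hΦ h'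
    exact ⟨_, BergmanSpace.norm_le_one_of_eq_mul hΦ h1, h1⟩
  · rintro ⟨c, hc, h⟩
    have hΨ := BergmanSpace.isAnalyticSelfMap_const_mul (c := starRingEnd ℂ c) (by simpa using hc)
    exact ⟨_, hΨ, BergmanSpace.adjoint_compOp_of_eq_mul hΦ hΨ h fun z _ => rfl⟩
  · intro c _ h Ψ hΨ
    refine ⟨fun hadj => ?_, BergmanSpace.adjoint_compOp_of_eq_mul hΦ hΨ h⟩
    -- This identifies the constant in the formula for `Ψ` with the conjugate of the given `c`.
    have hd : deriv Φ 0 = c := by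
      have h1 : Φ =ᶠ[nhds 0] fun z => c * z :=
        Filter.eventuallyEq_of_mem (Metric.ball_mem_nhds 0 one_pos) h
      rw [h1.deriv_eq]
      simp
    exact hd ▸ BergmanSpace.eq_conj_deriv_mul_of_adjoint_compOp hΦ hΨ hadj
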